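/- Let $\mathbb B$ be a real Banach space with a Schauder basis $(e_k)_{k\ge1}$, $\|e_k\|=1$, and write $x=\sum_k x_ke_k$, $P_nx=\sum_{k\le n}x_ke_k$. Let $$\mathbb B_J=\Big\{(x_k)\in\mathbb R^\infty:\ \sum_k x_ke_k\ \text{converges in }\mathbb B\Big\},\qquad \|(x_k)\|_{\mathbb B_J}=\sup_n\Big\|\sum_{k\le n}x_ke_k\Big\|,$$ and let $T:\mathbb B\to\mathbb B_J$ be the linear bijection $T x=(x_k)$. Put $j_k=\big[-\tfrac1{2\ln(k+1)},\tfrac1{2\ln(k+1)}\big]$ and, with $\lambda$ the Lebesgue measure on $\mathbb R$, $\nu_k(a)=\lambda(a)/\lambda(j_k)$ and $\mu_k(a)=\lambda(a\cap j_k)/\lambda(j_k)$. Let $V_j^n=\nu_1\times\cdots\times\nu_n\times\mu_{n+1}\times\mu_{n+2}\times\cdots$ on $\mathbb R^\infty$ and $V_j=\lim_nV_j^n$ (an increasing limit of measures). Equip $\mathbb B_J$ with the trace of the product $\sigma$-algebra of $\mathbb R^\infty$ and the restriction of $V_j$, and equip $\mathbb B$ with the $\sigma$-algebra $\{T^{-1}(a)\}$,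 $a$ running over the measurable subsets of $\mathbb B_J$, and the measure carried over by $T^{-1}$. Let $X$ be $\mathbb B$ or $\mathbb B_J$, $\mu$ its measure, $r,p\in[1,\infty]$, and consider real- or complex-valued functions. A *Kuelbs–Steadman system* on $X$ consists of a sequence $(\mathcal E_k)$ that is dense in the unit ball of $L^1(X)$ and weights $t_k>0$ with $\sum_kt_k=1$ such that the integrals below exist and $$\|f\|_{K^p}=\begin{cases}\Big(\sum_kt_k\big|\int_X\mathcal E_kf\,d\mu\big|^p\Big)^{1/p},&p<\infty,\\[2pt] \sup_k\big|\int_X\mathcal E_kf\,d\mu\big|,&p=\infty,\end{cases}$$ is finite for all $f\in L^r(X)$. The Kuelbs–Steadman space $K^p[X]$ of the system is the completion of $L^r(X)$ with respect to $\|\cdot\|_{K^p}$ (the main case is $r=p$; the case $r=1$ is also included). **Theorem.** (a) $\|x\|\le\sup_n\|P_nx\|\le C\|x\|$ for some constant $C$ and all $x\in\mathbb B$, and $\|Tx\|_{\mathbb B_J}=\sup_n\|P_nx\|$, so that $T$ is an isometric isomorphism of $\mathbb B$, with the equivalent norm $\sup_n\|P_nx\|$, onto $\mathbb B_J$. (b)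 $K^p[\mathbb B]$ and $K^p[\mathbb B_J]$ coincide via $T$, for all $r,p\in[1,\infty]$: if $(\mathcal E_k,t_k)$ is a Kuelbs–Steadman system on $\mathbb B$, then $(\mathcal E_k\circ T^{-1},t_k)$ is one on $\mathbb B_J$, and every system on $\mathbb B_J$ arises in this way; a function $f$ is in $L^r(\mathbb B)$ if and only if $f\circ T^{-1}$ is in $L^r(\mathbb B_J)$; and $f\mapsto f\circ T^{-1}$ extends to a linear isometry of $K^p[\mathbb B]$ onto $K^p[\mathbb B_J]$. -/

import Mathlib

open MeasureTheory Filter Topology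
open scoped ENNReal

noncomputable section

/-! ### The canonical image of a Banach space with a Schauder basis -/

section Canonical

variable {B : Type*} [NormedAddCommGroup B] [NormedSpace ℝ B]

/-- `𝔹_J`: the real sequences `(x_k)` for which `∑ x_k e_k` converges in `B`. -/
def BJ (b : SchauderBasis ℝ B) : Submodule ℝ (ℕ → ℝ) where
  carrier := {x | ∃ y : B, Tendsto (fun n => ∑ i ∈ Finset.range n, x i • b i) atTop (𝓝 y)}
  zero_mem' := ⟨0, by simp⟩
  add_mem' := by
    rintro x x' ⟨y, hy⟩ ⟨y', hy'⟩
    exact ⟨y + y', by simpa [add_smul, Finset.sum_add_distrib] using hy.add hy'⟩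
  smul_mem' := by
    rintro c x ⟨y, hy⟩
    exact ⟨c • y, by simpa [Finset.smul_sum, smul_smul] using hy.const_smul c⟩

/-- The norm of `𝔹_J`: the supremum of the norms of the partial sums `∑_{i < n} x_i e_i`. -/
def bjNorm (b : SchauderBasis ℝ B) (x : BJ b) : ℝ :=
  ⨆ n, ‖∑ i ∈ Finset.range n, (x : ℕ → ℝ) i • b i‖

/-- The norm `sup_n ‖P_n x‖` on `B` attached to the basis. -/
def basisNorm (b : SchauderBasis ℝ B) (x : B) : ℝ := ⨆ n, ‖b.proj n x‖

theorem coord_mem_BJ (b : SchauderBasis ℝ B) (x : B) : (fun k => b.coord k x) ∈ BJ b :=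
  ⟨x, by simpa using b.tendsto_proj x⟩

theorem coord_eq_of_tendsto (b : SchauderBasis ℝ B) {x : ℕ → ℝ} {y : B}
    (h : Tendsto (fun n => ∑ i ∈ Finset.range n, x i • b i) atTop (𝓝 y)) (k : ℕ) :
    b.coord k y = x k := by
  have h1 := ((b.coord k).continuous.tendsto y).comp h
  refine tendsto_nhds_unique h1 (tendsto_const_nhds.congr' ?_)
  filter_upwards [eventually_gt_atTop k] with n hn
  simp [b.ortho, Pi.single_apply, hn]

/-- The operator `T : B → 𝔹_J`, `T x = (x_k)`, sending a vector to its sequence of coordinates. -/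
def canonT (b : SchauderBasis ℝ B) : B ≃ₗ[ℝ] BJ b :=
  LinearEquiv.ofBijective
    { toFun := fun x => ⟨fun k => b.coord k x, coord_mem_BJ b x⟩
      map_add' := fun x y => by ext k; simp
      map_smul' := fun c x => by ext k; simp }
    ⟨fun x y h => by
      have h' : ∀ k, b.coord k x = b.coord k y := fun k =>
        congrFun (congrArg Subtype.val h) k
      refine tendsto_nhds_unique (b.tendsto_proj x) ?_
      simpa [h'] using b.tendsto_proj y,
    fun x => by
      obtain ⟨y, hy⟩ := x.2
      exact ⟨y, Subtype.ext (funext fun k => coord_eq_of_tendsto b hy k)⟩⟩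

end Canonical

/-! ### The measure on sequence space -/

/-- The interval `j_k = [-1/(2 ln(k+1)), 1/(2 ln(k+1))]`, `k ≥ 1`; the index is shifted by one, so
that the first interval is `jInt 0`. -/
def jInt (k : ℕ) : Set ℝ :=
  Set.Icc (-(1 / (2 * Real.log ((k : ℝ) + 2)))) (1 / (2 * Real.log ((k : ℝ) + 2)))

/-- `ν_k(a) = μ(a) / μ(j_k)` with `μ` the Lebesgue measure of the line. -/
def nuJ (k : ℕ) : Measure ℝ := (volume (jInt k))⁻¹ • volume

/-- `μ_k(a) = μ(a ∩ j_k) / μ(j_k)`. -/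
def muJ (k : ℕ) : Measure ℝ := (volume (jInt k))⁻¹ • volume.restrict (jInt k)

/-- The sequence whose first `n` terms are those of `q.1` and whose other terms are those of
`q.2`. -/
def joinSeq (n : ℕ) (q : (Fin n → ℝ) × (ℕ → ℝ)) : ℕ → ℝ :=
  fun k => if h : k < n then q.1 ⟨k, h⟩ else q.2 k

/-- `V_j^n`: the product measure `ν_1 × ⋯ × ν_n × μ_{n+1} × μ_{n+2} × ⋯` on the space of real
sequences. -/
def volJn (n : ℕ) : Measure (ℕ → ℝ) :=
  ((Measure.pi fun i : Fin n => nuJ i).prod (Measure.infinitePi muJ)).map (joinSeq n)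

/-- `V_j = lim_n V_j^n`, the supremum of an increasing sequence of measures. -/
def volJ : Measure (ℕ → ℝ) := ⨆ n, volJn n

theorem volume_jInt_ne_zero (k : ℕ) : volume (jInt k) ≠ 0 := by
  have h : 0 < Real.log ((k : ℝ) + 2) := Real.log_pos (by have : (0:ℝ) ≤ k := k.cast_nonneg; linarith)
  have : 0 < 1 / (2 * Real.log ((k : ℝ) + 2)) := by positivity
  simp only [jInt, Real.volume_Icc, ne_eq, ENNReal.ofReal_eq_zero, not_le]
  linarith

theorem volume_jInt_ne_top (k : ℕ) : volume (jInt k) ≠ ∞ := by simp [jInt]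

instance (k : ℕ) : IsProbabilityMeasure (muJ k) :=
  ⟨by simp [muJ, ENNReal.inv_mul_cancel (volume_jInt_ne_zero k) (volume_jInt_ne_top k)]⟩

instance (k : ℕ) : SigmaFinite (nuJ k) := by
  unfold nuJ
  have h : (volume (jInt k))⁻¹ ≠ ∞ := ENNReal.inv_ne_top.2 (volume_jInt_ne_zero k)
  lift (volume (jInt k))⁻¹ to NNReal using h with c
  change SigmaFinite (c • volume)
  infer_instance

theorem muJ_le_nuJ (k : ℕ) : muJ k ≤ nuJ k := by
  unfold muJ nuJ
  gcongr
  exact Measure.restrict_le_self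

theorem measurable_joinSeq (n : ℕ) : Measurable (joinSeq n) := by
  refine measurable_pi_lambda _ fun k => ?_
  unfold joinSeq
  split_ifs <;> fun_prop

theorem measurable_updateSeq (n : ℕ) :
    Measurable (fun q : ℝ × (ℕ → ℝ) => Function.update q.2 n q.1) := by
  refine measurable_pi_lambda _ fun k => ?_
  rcases eq_or_ne k n with rfl | h
  · simpa using measurable_fst
  · simp only [Function.update_of_ne h]
    fun_prop

theorem map_update_infinitePi (n : ℕ) :
    ((muJ n).prod (Measure.infinitePi muJ)).map
      (fun q : ℝ × (ℕ → ℝ) => Function.update q.2 n q.1) = Measure.infinitePi muJ := by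
  have hm := measurable_updateSeq n
  refine Measure.eq_infinitePi _ fun s t ht => ?_
  rw [Measure.map_apply hm (MeasurableSet.pi s.countable_toSet fun i _ => ht i)]
  by_cases hn : n ∈ s
  · have : (fun q : ℝ × (ℕ → ℝ) => Function.update q.2 n q.1) ⁻¹' (Set.pi s t)
        = t n ×ˢ (Set.pi (s.erase n : Finset ℕ) t) := by
      ext ⟨a, v⟩
      simp only [Set.mem_preimage, Set.mem_pi, Set.mem_prod, Finset.mem_coe, Finset.mem_erase]
      constructor
      · intro h
        refine ⟨by simpa using h n hn, fun i hi => by simpa [hi.1] using h i hi.2⟩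
      · rintro ⟨h1, h2⟩ i hi
        rcases eq_or_ne i n with rfl | h
        · simpa using h1
        · simpa [h] using h2 i ⟨h, hi⟩
    rw [this, Measure.prod_prod, Measure.infinitePi_pi _ fun i _ => ht i,
      Finset.mul_prod_erase s (fun i => muJ i (t i)) hn]
  · have : (fun q : ℝ × (ℕ → ℝ) => Function.update q.2 n q.1) ⁻¹' (Set.pi s t)
        = Set.univ ×ˢ (Set.pi s t) := by
      ext ⟨a, v⟩
      simp only [Set.mem_preimage, Set.mem_pi, Set.mem_prod, Finset.mem_coe, Set.mem_univ, true_and]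
      refine forall₂_congr fun i hi => ?_
      have : i ≠ n := fun h => hn (h ▸ hi)
      simp [this]
    rw [this, Measure.prod_prod, Measure.infinitePi_pi _ fun i _ => ht i]
    simp

theorem volJn_le_succ (n : ℕ) : volJn n ≤ volJn (n + 1) := by
  have hu := measurable_updateSeq n
  -- both measures as images of measures on `ℝ^n × (ℝ × ℝ^ℕ)`
  let G : (Fin n → ℝ) × (ℝ × (ℕ → ℝ)) → ℕ → ℝ :=
    fun q => joinSeq n (q.1, Function.update q.2.2 n q.2.1)
  have h1 : volJn n = ((Measure.pi fun i : Fin n => nuJ i).prod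
      ((muJ n).prod (Measure.infinitePi muJ))).map G := by
    have := Measure.map_prod_map (Measure.pi fun i : Fin n => nuJ i)
      ((muJ n).prod (Measure.infinitePi muJ)) measurable_id hu
    rw [map_update_infinitePi, Measure.map_id] at this
    rw [volJn, this, Measure.map_map (measurable_joinSeq n) (by fun_prop)]
    rfl
  have hG : Measurable G := (measurable_joinSeq n).comp
    (measurable_fst.prodMk (hu.comp measurable_snd))
  have h2 : volJn (n + 1) = ((Measure.pi fun i : Fin n => nuJ i).prod
      ((nuJ n).prod (Measure.infinitePi muJ))).map G := by
    have e := (measurePreserving_piFinSuccAbove (fun i : Fin (n + 1) => nuJ i) (Fin.last n)).symm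
    have hs : Measurable (fun q : (Fin n → ℝ) × (ℝ × (ℕ → ℝ)) => ((q.2.1, q.1), q.2.2)) := by
      fun_prop
    have h3 : ((Measure.pi fun i : Fin n => nuJ i).prod
        ((nuJ n).prod (Measure.infinitePi muJ))).map
        (fun q : (Fin n → ℝ) × (ℝ × (ℕ → ℝ)) => ((q.2.1, q.1), q.2.2))
        = ((nuJ n).prod (Measure.pi fun i : Fin n => nuJ i)).prod (Measure.infinitePi muJ) := by
      have hsw := (Measure.measurePreserving_swap (μ := Measure.pi fun i : Fin n => nuJ i)
        (ν := nuJ n)).prod (MeasurePreserving.id (Measure.infinitePi muJ))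
      have has := (measurePreserving_prodAssoc (Measure.pi fun i : Fin n => nuJ i) (nuJ n)
        (Measure.infinitePi muJ)).symm
      exact (hsw.comp has).map_eq
    have h4 := (e.prod (MeasurePreserving.id (Measure.infinitePi muJ))).map_eq
    simp only [Fin.succAbove_last, Fin.val_castSucc, Fin.val_last] at h4
    rw [volJn, ← h4, ← h3, Measure.map_map (by fun_prop) hs,
      Measure.map_map (measurable_joinSeq _) (by fun_prop)]
    congr 1
    ext q k
    rcases q with ⟨u, a, v⟩
    simp only [Function.comp, G, joinSeq]
    rcases lt_trichotomy k n with h | rfl | h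
    · have hk : (⟨k, h.trans (Nat.lt_succ_self n)⟩ : Fin (n + 1)) = Fin.castSucc ⟨k, h⟩ := rfl
      simp only [h, h.trans (Nat.lt_succ_self n), dif_pos, hk]
      have h5 : Fin.snoc (α := fun _ => ℝ) u a (Fin.castSucc ⟨k, h⟩) = u ⟨k, h⟩ :=
        Fin.snoc_castSucc (α := fun _ => ℝ) a u ⟨k, h⟩
      simp [MeasurableEquiv.piFinSuccAbove]
      exact h5
    · have hk : (⟨k, Nat.lt_succ_self k⟩ : Fin (k + 1)) = Fin.last k := rfl
      simp only [Nat.lt_succ_self, dif_pos, lt_irrefl, dif_neg, not_false_eq_true, hk]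
      simp [MeasurableEquiv.piFinSuccAbove]
    · simp [h.not_gt, show ¬ k < n + 1 by omega, h.ne']
  rw [h1, h2]
  exact Measure.map_mono (Measure.prod_mono le_rfl (Measure.prod_mono (muJ_le_nuJ n) le_rfl)) hG

theorem iSup_measure_apply {α : Type*} {_ : MeasurableSpace α} (μ : ℕ → Measure α)
    (hμ : Monotone μ) {s : Set α} (hs : MeasurableSet s) : (⨆ n, μ n) s = ⨆ n, μ n s := by
  refine le_antisymm ?_ (iSup_le fun n => Measure.le_iff'.1 (le_iSup μ n) s)
  let ν : Measure α := Measure.ofMeasurable (fun s _ => ⨆ n, μ n s) (by simp) (by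
    intro f hf hd
    simp only [fun n => measure_iUnion (μ := μ n) hd hf, ENNReal.tsum_eq_iSup_sum]
    rw [iSup_comm]
    refine iSup_congr fun t => ?_
    rw [ENNReal.finsetSum_iSup_of_monotone]
    exact fun i m n hmn => Measure.le_iff'.1 (hμ hmn) (f i))
  have hν : ∀ s, MeasurableSet s → ν s = ⨆ n, μ n s := fun s hs => Measure.ofMeasurable_apply s hs
  rw [← hν s hs]
  refine Measure.le_iff'.1 (iSup_le fun n => Measure.le_iff.2 fun t ht => ?_) s
  rw [hν t ht]
  exact le_iSup (fun n => μ n t) n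

/-- `V_j(a) = lim_n V_j^n(a)`. -/
theorem tendsto_volJn {s : Set (ℕ → ℝ)} (hs : MeasurableSet s) :
    Tendsto (fun n => volJn n s) atTop (𝓝 (volJ s)) := by
  have hm : Monotone volJn := monotone_nat_of_le_succ volJn_le_succ
  rw [volJ, iSup_measure_apply _ hm hs]
  exact tendsto_atTop_iSup fun m n hmn => Measure.le_iff'.1 (hm hmn) s

section Measures

variable {B : Type*} [NormedAddCommGroup B] [NormedSpace ℝ B]

/-- The measure `V_j` on `𝔹_J`, with the trace on `𝔹_J` of the `σ`-algebra of the sequence space. -/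
def volBJ (b : SchauderBasis ℝ B) : Measure (BJ b) := volJ.comap Subtype.val

/-- The `σ`-algebra `{T⁻¹(a)}` on `B`, `a` running over the measurable subsets of `𝔹_J`. -/
@[reducible] def canonSigma (b : SchauderBasis ℝ B) : MeasurableSpace B :=
  MeasurableSpace.comap (canonT b) inferInstance

/-- The measure on `B` carried over from `𝔹_J` by `T⁻¹`. -/
def volB (b : SchauderBasis ℝ B) : @Measure B (canonSigma b) :=
  @Measure.map _ _ _ (canonSigma b) (canonT b).symm (volBJ b)

theorem measurableSet_BJ [CompleteSpace B] (b : SchauderBasis ℝ B) :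
    MeasurableSet (BJ b : Set (ℕ → ℝ)) := by
  have h : (BJ b : Set (ℕ → ℝ)) = {x | ∀ m : ℕ, ∃ N : ℕ, ∀ n, N ≤ n →
      ‖∑ i ∈ Finset.range n, x i • b i - ∑ i ∈ Finset.range N, x i • b i‖ < 1 / ((m : ℝ) + 1)} := by
    ext x
    have h1 : x ∈ (BJ b : Set (ℕ → ℝ)) ↔
        CauchySeq (fun n => ∑ i ∈ Finset.range n, x i • b i) :=
      ⟨fun ⟨y, hy⟩ => hy.cauchySeq, fun h => cauchySeq_tendsto_of_complete h⟩
    rw [h1, Metric.cauchySeq_iff']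
    simp only [Set.mem_ofPred_eq, dist_eq_norm]
    constructor
    · intro h m
      exact h _ (by positivity)
    · intro h ε hε
      obtain ⟨m, hm⟩ := exists_nat_one_div_lt hε
      obtain ⟨N, hN⟩ := h m
      exact ⟨N, fun n hn => (hN n hn).trans hm⟩
  rw [h]
  simp only [Set.ofPred_forall, Set.ofPred_exists]
  refine MeasurableSet.iInter fun m => MeasurableSet.iUnion fun N => MeasurableSet.iInter fun n =>
    MeasurableSet.iInter fun _ => IsOpen.measurableSet (isOpen_lt ?_ continuous_const)
  fun_prop

theorem volBJ_apply [CompleteSpace B] (b : SchauderBasis ℝ B) (s : Set (BJ b)) :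
    volBJ b s = volJ (Subtype.val '' s) :=
  comap_subtype_coe_apply (measurableSet_BJ b) _ s

theorem volB_apply (b : SchauderBasis ℝ B) {a : Set (BJ b)} (ha : MeasurableSet a) :
    volB b (canonT b ⁻¹' a) = volBJ b a := by
  have hm : @Measurable _ _ _ (canonSigma b) (canonT b).symm := by
    rintro _ ⟨t, ht, rfl⟩
    have : (canonT b).symm ⁻¹' (canonT b ⁻¹' t) = t := by ext; simp
    rwa [this]
  rw [volB, @Measure.map_apply _ _ _ (canonSigma b) _ _ hm _ ⟨a, ha, rfl⟩]
  congr 1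
  ext
  simp

end Measures

/-! ### The Kuelbs–Steadman spaces -/

/-- The data defining a Kuelbs–Steadman space: a sequence `E` that is dense in the unit ball of
`L¹(μ)` and weights `t_k > 0` with sum `1`, such that the expression `ksNorm` below is meaningful
(its integrals exist and it is finite) on all of `L^r(μ)`. -/
structure KSSystem (𝕜 : Type*) [RCLike 𝕜] {α : Type*} {_ : MeasurableSpace α} (μ : Measure α)
    (r p : ℝ≥0∞) where
  E : ℕ → α → 𝕜
  t : ℕ → ℝ
  memLp : ∀ k, MemLp (E k) 1 μ
  norm_le : ∀ k, eLpNorm (E k) 1 μ ≤ 1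
  dense : ∀ g : α → 𝕜, MemLp g 1 μ → eLpNorm g 1 μ ≤ 1 →
    ∀ ε : ℝ≥0∞, 0 < ε → ∃ k, eLpNorm (g - E k) 1 μ < ε
  t_pos : ∀ k, 0 < t k
  t_sum : HasSum t 1
  integrable : ∀ f : α → 𝕜, MemLp f r μ → ∀ k, Integrable (fun x => E k x * f x) μ
  summable : p ≠ ∞ → ∀ f : α → 𝕜, MemLp f r μ →
    Summable fun k => t k * ‖∫ x, E k x * f x ∂μ‖ ^ p.toReal
  bddAbove : p = ∞ → ∀ f : α → 𝕜, MemLp f r μ →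
    BddAbove (Set.range fun k => ‖∫ x, E k x * f x ∂μ‖)

namespace KSSystem

variable {𝕜 : Type*} [RCLike 𝕜] {α : Type*} {_ : MeasurableSpace α} {μ : Measure α} {r p : ℝ≥0∞}

/-- `‖f‖_{K^p} = (∑ t_k |∫ E_k f|^p)^{1/p}` for `p < ∞` and `sup_k |∫ E_k f|` for `p = ∞`. -/
def ksNorm (S : KSSystem 𝕜 μ r p) (f : α → 𝕜) : ℝ :=
  if p = ∞ then ⨆ k, ‖∫ x, S.E k x * f x ∂μ‖
  else (∑' k, S.t k * ‖∫ x, S.E k x * f x ∂μ‖ ^ p.toReal) ^ (1 / p.toReal)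

/-- The functional `f ↦ ∫ E_k f` on `L^r`. -/
def coeff (S : KSSystem 𝕜 μ r p) (k : ℕ) : Lp 𝕜 r μ →ₗ[𝕜] 𝕜 where
  toFun f := ∫ x, S.E k x * f x ∂μ
  map_add' f g := by
    rw [← integral_add (S.integrable f (Lp.memLp f) k) (S.integrable g (Lp.memLp g) k)]
    refine integral_congr_ae ?_
    filter_upwards [Lp.coeFn_add f g] with x hx
    rw [hx, Pi.add_apply, mul_add]
  map_smul' c f := by
    rw [RingHom.id_apply, smul_eq_mul, ← integral_const_mul]
    refine integral_congr_ae ?_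
    filter_upwards [Lp.coeFn_smul c f] with x hx
    simp only [hx, Pi.smul_apply, smul_eq_mul]
    ring

/-- The sequence `(t_k^{1/p} ∫ E_k f)_k`, whose `ℓ^p` norm is `ksNorm`. -/
def seq (S : KSSystem 𝕜 μ r p) (f : Lp 𝕜 r μ) : ℕ → 𝕜 :=
  fun k => ((S.t k ^ (1 / p.toReal) : ℝ) : 𝕜) * S.coeff k f

theorem norm_seq_top (S : KSSystem 𝕜 μ r p) (hp : p = ∞) (f : Lp 𝕜 r μ) (k : ℕ) :
    ‖S.seq f k‖ = ‖∫ x, S.E k x * f x ∂μ‖ := by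
  subst hp
  simp [seq, coeff]

theorem norm_seq_rpow [Fact (1 ≤ p)] (S : KSSystem 𝕜 μ r p) (hp : p ≠ ∞) (f : Lp 𝕜 r μ) (k : ℕ) :
    ‖S.seq f k‖ ^ p.toReal = S.t k * ‖∫ x, S.E k x * f x ∂μ‖ ^ p.toReal := by
  have hp0 : p.toReal ≠ 0 :=
    (ENNReal.toReal_pos (zero_lt_one.trans_le Fact.out).ne' hp).ne'
  have ht := (S.t_pos k).le
  rw [seq, norm_mul, Real.mul_rpow (norm_nonneg _) (norm_nonneg _), RCLike.norm_ofReal,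
    abs_of_nonneg (Real.rpow_nonneg ht _), ← Real.rpow_mul ht, one_div_mul_cancel hp0,
    Real.rpow_one]
  rfl

theorem memℓp_seq [Fact (1 ≤ p)] (S : KSSystem 𝕜 μ r p) (f : Lp 𝕜 r μ) : Memℓp (S.seq f) p := by
  by_cases hp : p = ∞
  · have h := S.bddAbove hp f (Lp.memLp f)
    simp only [← S.norm_seq_top hp] at h
    subst hp
    exact memℓp_infty h
  · have h := S.summable hp f (Lp.memLp f)
    simp only [← S.norm_seq_rpow hp] at h
    exact memℓp_gen h

/-- `seq` as a linear map into `ℓ^p`. -/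
def toSeq [Fact (1 ≤ p)] (S : KSSystem 𝕜 μ r p) : Lp 𝕜 r μ →ₗ[𝕜] lp (fun _ : ℕ => 𝕜) p where
  toFun f := ⟨S.seq f, S.memℓp_seq f⟩
  map_add' f g := by
    ext k
    change S.seq (f + g) k = S.seq f k + S.seq g k
    simp [seq, mul_add]
  map_smul' c f := by
    ext k
    change S.seq (c • f) k = c * S.seq f k
    simp [seq, mul_left_comm]

theorem norm_toSeq [Fact (1 ≤ p)] (S : KSSystem 𝕜 μ r p) (f : Lp 𝕜 r μ) :
    ‖S.toSeq f‖ = S.ksNorm f := by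
  by_cases hp : p = ∞
  · simp only [ksNorm, hp, if_true, ← S.norm_seq_top hp]
    subst hp
    exact lp.norm_eq_ciSup _
  · have hp0 : 0 < p.toReal := ENNReal.toReal_pos (zero_lt_one.trans_le Fact.out).ne' hp
    simp only [ksNorm, hp, if_false, ← S.norm_seq_rpow hp]
    exact lp.norm_eq_tsum_rpow hp0 _

/-- `ksNorm` as a seminorm on `L^r`. -/
def ksSeminorm [Fact (1 ≤ p)] (S : KSSystem 𝕜 μ r p) : Seminorm 𝕜 (Lp 𝕜 r μ) :=
  Seminorm.of (fun f => S.ksNorm f)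
    (fun f g => by simp only [← S.norm_toSeq, map_add]; exact norm_add_le _ _)
    (fun c f => by simp only [← S.norm_toSeq, map_smul]; exact norm_smul _ _)

/-- `L^r(μ)`, equipped with `ksNorm` instead of its own norm. -/
def Pre (_ : KSSystem 𝕜 μ r p) : Type _ := Lp 𝕜 r μ

instance (S : KSSystem 𝕜 μ r p) : AddCommGroup S.Pre := inferInstanceAs (AddCommGroup (Lp 𝕜 r μ))

instance (S : KSSystem 𝕜 μ r p) : Module 𝕜 S.Pre := inferInstanceAs (Module 𝕜 (Lp 𝕜 r μ))

instance [Fact (1 ≤ p)] (S : KSSystem 𝕜 μ r p) : SeminormedAddCommGroup S.Pre :=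
  S.ksSeminorm.toAddGroupSeminorm.toSeminormedAddCommGroup

instance [Fact (1 ≤ p)] (S : KSSystem 𝕜 μ r p) : NormedSpace 𝕜 S.Pre :=
  { (inferInstance : Module 𝕜 S.Pre) with
    norm_smul_le := fun c f => (map_smul_eq_mul S.ksSeminorm c f).le }

/-- The Kuelbs–Steadman space: the completion of `L^r(μ)` with respect to `ksNorm`. -/
abbrev KSpace [Fact (1 ≤ p)] (S : KSSystem 𝕜 μ r p) : Type _ := UniformSpace.Completion S.Pre

/-- The canonical map of `L^r(μ)` into the Kuelbs–Steadman space. -/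
def incl [Fact (1 ≤ p)] (S : KSSystem 𝕜 μ r p) (f : α → 𝕜) (hf : MemLp f r μ) : S.KSpace :=
  UniformSpace.Completion.coe' (show S.Pre from hf.toLp f)

theorem norm_incl [Fact (1 ≤ p)] (S : KSSystem 𝕜 μ r p) (f : α → 𝕜) (hf : MemLp f r μ) :
    ‖S.incl f hf‖ = S.ksNorm f := by
  rw [incl, UniformSpace.Completion.norm_coe]
  change S.ksNorm (hf.toLp f) = _
  have h : ∀ k, ∫ x, S.E k x * (hf.toLp f) x ∂μ = ∫ x, S.E k x * f x ∂μ := fun k =>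
    integral_congr_ae (by filter_upwards [hf.coeFn_toLp] with x hx; rw [hx])
  simp only [ksNorm, h]

end KSSystem

/-- The Kuelbs–Steadman spaces of `S` (over `α`) and `S'` (over `β`) are identified by the bijection
`T : α → β`: the defining data correspond to each other under `T`, a function `f` is in `L^r` on
`α` exactly if `f ∘ T⁻¹` is in `L^r` on `β`, and `f ↦ f ∘ T⁻¹` extends to a surjective linear
isometry of the two spaces. -/
def IdentifiedBy {𝕜 : Type*} [RCLike 𝕜] {α β : Type*} {_ : MeasurableSpace α}
    {_ : MeasurableSpace β} {μ : Measure α} {ν : Measure β} {r p : ℝ≥0∞} [Fact (1 ≤ p)]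
    (T : α ≃ β) (S : KSSystem 𝕜 μ r p) (S' : KSSystem 𝕜 ν r p) : Prop :=
  S'.t = S.t ∧ (∀ k, S'.E k = S.E k ∘ T.symm) ∧
  (∀ f : α → 𝕜, MemLp f r μ ↔ MemLp (f ∘ T.symm) r ν) ∧
  ∃ Φ : S.KSpace ≃ₗᵢ[𝕜] S'.KSpace, ∀ (f : α → 𝕜) (hf : MemLp f r μ)
    (hf' : MemLp (f ∘ T.symm) r ν), Φ (S.incl f hf) = S'.incl (f ∘ T.symm) hf'

end

/-! Part (b) is transport of structure. The `σ`-algebra and the measure of `B` are by definition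
carried over from `𝔹_J` along `T`, so `T` is a measure preserving measurable equivalence
(`measurePreserving_canonMeasurableEquiv`); no further property of `V_j` enters. A Kuelbs–Steadman
system is described by `L¹` and `L^r` membership, `L¹` distances and the integrals `∫ E_k f`, all
invariant under such an equivalence. Hence `KSSystem.transport` moves systems in either direction,
and composition with `T⁻¹` is a linear bijection of the `L^r` spaces that preserves `ksNorm`, so it
extends to the completions.

Part (a): the lower bound comes from `P_n x → x`, the upper bound from uniform boundedness of the
projections on the complete space `B`. -/

open MeasureTheory Filter Topology UniformSpace
open scoped ENNReal

/-! ### Extension of isometries to completions. -/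

section Completion

variable {𝕜 E F : Type*} [NontriviallyNormedField 𝕜] [SeminormedAddCommGroup E] [NormedSpace 𝕜 E]
  [SeminormedAddCommGroup F] [NormedSpace 𝕜 F]

/-- A linear isometric equivalence as a uniform equivalence. -/
def LinearIsometryEquiv.toUniformEquiv (L : E ≃ₗᵢ[𝕜] F) : E ≃ᵤ F where
  toEquiv := L.toEquiv
  uniformContinuous_toFun := L.isometry.uniformContinuous
  uniformContinuous_invFun := L.symm.isometry.uniformContinuous

/-- A linear isometric equivalence of seminormed spaces extends to their completions. -/
noncomputable def LinearIsometryEquiv.completionCongr (L : E ≃ₗᵢ[𝕜] F) :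
    Completion E ≃ₗᵢ[𝕜] Completion F :=
  -- The uniform equivalence supplies bijectivity, the completed continuous linear map supplies
  -- linearity. The two agree on the dense image of `E`, hence everywhere.
  let e := Completion.mapEquiv L.toUniformEquiv
  have he : ∀ x, e x = (L.toContinuousLinearEquiv : E →L[𝕜] F).completion x := fun x => by
    induction x using Completion.induction_on with
    | hp => exact isClosed_eq e.continuous (ContinuousLinearMap.continuous _)
    | ih a =>
      rw [ContinuousLinearMap.completion_apply_coe]
      exact Completion.mapEquiv_coe _ a
  { e.toEquiv with
    map_add' := fun x y => by
      change e (x + y) = e x + e y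
      rw [he, he, he]
      exact ContinuousLinearMap.map_add _ x y
    map_smul' := fun c x => by
      change e (c • x) = c • e x
      rw [he, he]
      exact ContinuousLinearMap.map_smul _ c x
    norm_map' := fun x => by
      change ‖e x‖ = ‖x‖
      induction x using Completion.induction_on with
      | hp => exact isClosed_eq e.continuous.norm continuous_norm
      | ih a =>
        rw [show e a = (L a : Completion F) from Completion.mapEquiv_coe _ a,
          Completion.norm_coe, Completion.norm_coe, L.norm_map] }

theorem LinearIsometryEquiv.completionCongr_coe (L : E ≃ₗᵢ[𝕜] F) (a : E) :
    L.completionCongr (a : Completion E) = (L a : Completion F) :=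
  Completion.mapEquiv_coe L.toUniformEquiv a

end Completion

/-! ### Invariance under measure preserving equivalences. -/

section Transport

variable {𝕜 : Type*} [RCLike 𝕜] {α β : Type*} [MeasurableSpace α] [MeasurableSpace β]
  {μ : Measure α} {ν : Measure β} {r p : ℝ≥0∞}

/-- Since `e` is a measurable embedding, `g` need not be measurable; the same holds for the next two
lemmas. -/
theorem MeasureTheory.MeasurePreserving.eLpNorm_comp_equiv {e : α ≃ᵐ β}
    (he : MeasurePreserving e μ ν) (g : β → 𝕜) : eLpNorm (g ∘ e) r μ = eLpNorm g r ν := by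
  rw [← he.map_eq, e.measurableEmbedding.eLpNorm_map_measure]

theorem MeasureTheory.MeasurePreserving.memLp_comp_equiv {e : α ≃ᵐ β}
    (he : MeasurePreserving e μ ν) {g : β → 𝕜} : MemLp (g ∘ e) r μ ↔ MemLp g r ν := by
  rw [← he.map_eq, e.memLp_map_measure_iff]

/-- A change of variables that moves `e` from the system functions to the argument `f`: each
condition on the transported system at `f` becomes the original one at `f ∘ e`. -/
theorem MeasureTheory.MeasurePreserving.integral_comp_symm_mul {e : α ≃ᵐ β}
    (he : MeasurePreserving e μ ν) (g : α → 𝕜) (f : β → 𝕜) :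
    ∫ y, (g ∘ e.symm) y * f y ∂ν = ∫ x, g x * (f ∘ e) x ∂μ := by
  rw [← he.integral_comp' (fun y => (g ∘ e.symm) y * f y)]
  simp

namespace KSSystem

/-- The image of a Kuelbs–Steadman system under a measure preserving equivalence. -/
noncomputable def transport (S : KSSystem 𝕜 μ r p) (e : α ≃ᵐ β) (he : MeasurePreserving e μ ν) :
    KSSystem 𝕜 ν r p where
  E k := S.E k ∘ e.symm
  t := S.t
  memLp k := (he.symm e).memLp_comp_equiv.2 (S.memLp k)
  norm_le k := ((he.symm e).eLpNorm_comp_equiv _).trans_le (S.norm_le k)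
  dense g hg hg1 ε hε := by
    -- Approximate the pullback `g ∘ e`; the same index works for `g`, because `(g - E k ∘ e.symm) ∘
    -- e = g ∘ e - E k`.
    obtain ⟨k, hk⟩ := S.dense (g ∘ e) (he.memLp_comp_equiv.2 hg)
      ((he.eLpNorm_comp_equiv g).trans_le hg1) ε hε
    refine ⟨k, ?_⟩
    rw [← he.eLpNorm_comp_equiv]
    convert hk using 2
    ext x
    simp
  t_pos := S.t_pos
  t_sum := S.t_sum
  integrable f hf k := by
    rw [← he.integrable_comp_emb e.measurableEmbedding]
    convert S.integrable (f ∘ e) (he.memLp_comp_equiv.2 hf) k using 2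
    simp
  summable hp f hf := by
    simp only [he.integral_comp_symm_mul]
    exact S.summable hp (f ∘ e) (he.memLp_comp_equiv.2 hf)
  bddAbove hp f hf := by
    simp only [he.integral_comp_symm_mul]
    exact S.bddAbove hp (f ∘ e) (he.memLp_comp_equiv.2 hf)

/-- Needed because the representative of a composition in `Lp` is the composed function only almost
everywhere. -/
theorem ksNorm_congr_ae (S : KSSystem 𝕜 μ r p) {f g : α → 𝕜} (h : f =ᵐ[μ] g) :
    S.ksNorm f = S.ksNorm g := by
  have h' : ∀ k, ∫ x, S.E k x * f x ∂μ = ∫ x, S.E k x * g x ∂μ := fun k =>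
    integral_congr_ae (by filter_upwards [h] with x hx; rw [hx])
  simp only [ksNorm, h']

theorem ksNorm_comp_symm (S : KSSystem 𝕜 μ r p) (S' : KSSystem 𝕜 ν r p) {e : α ≃ᵐ β}
    (he : MeasurePreserving e μ ν) (ht : S'.t = S.t) (hE : ∀ k, S'.E k = S.E k ∘ e.symm)
    (f : α → 𝕜) : S'.ksNorm (f ∘ e.symm) = S.ksNorm f := by
  have h : ∀ k, ∫ y, S'.E k y * (f ∘ e.symm) y ∂ν = ∫ x, S.E k x * f x ∂μ := fun k => by
    rw [hE, he.integral_comp_symm_mul]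
    simp
  simp only [ksNorm, h, ht]

end KSSystem

/-- Composition with a measure preserving equivalence, as a linear equivalence of `L^r` spaces. -/
noncomputable def lpCompEquiv (𝕜 : Type*) [RCLike 𝕜] (r : ℝ≥0∞) (e : α ≃ᵐ β)
    (he : MeasurePreserving e μ ν) : Lp 𝕜 r μ ≃ₗ[𝕜] Lp 𝕜 r ν :=
  LinearEquiv.ofLinearMap (Lp.compMeasurePreservingₗ 𝕜 e.symm (he.symm e))
    (Lp.compMeasurePreservingₗ 𝕜 e he)
    (by
      ext1 g
      refine Lp.ext ((Lp.coeFn_compMeasurePreserving _ (he.symm e)).trans ?_)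
      -- The inner composition is known only off a null set of `α`, and that set must be pulled back
      -- to a null set of `β`.
      filter_upwards [(he.symm e).quasiMeasurePreserving.ae_eq_comp
        (Lp.coeFn_compMeasurePreserving g he)] with y hy
      refine hy.trans ?_
      simp)
    (by
      ext1 g
      refine Lp.ext ((Lp.coeFn_compMeasurePreserving _ he).trans ?_)
      filter_upwards [he.quasiMeasurePreserving.ae_eq_comp
        (Lp.coeFn_compMeasurePreserving g (he.symm e))] with x hx
      refine hx.trans ?_
      simp)

theorem KSSystem.ksNorm_lpCompEquiv (S : KSSystem 𝕜 μ r p) (S' : KSSystem 𝕜 ν r p) {e : α ≃ᵐ β}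
    (he : MeasurePreserving e μ ν) (ht : S'.t = S.t) (hE : ∀ k, S'.E k = S.E k ∘ e.symm)
    (f : Lp 𝕜 r μ) : S'.ksNorm (lpCompEquiv 𝕜 r e he f) = S.ksNorm f :=
  (S'.ksNorm_congr_ae (Lp.coeFn_compMeasurePreserving f (he.symm e))).trans
    (S.ksNorm_comp_symm S' he ht hE f)

theorem KSSystem.identifiedBy [Fact (1 ≤ p)] (S : KSSystem 𝕜 μ r p) (S' : KSSystem 𝕜 ν r p)
    {e : α ≃ᵐ β} (he : MeasurePreserving e μ ν) (ht : S'.t = S.t)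
    (hE : ∀ k, S'.E k = S.E k ∘ e.symm) : IdentifiedBy e.toEquiv S S' := by
  refine ⟨ht, hE, fun f => (he.symm e).memLp_comp_equiv.symm, ?_⟩
  -- The map of `L^r` spaces is reread between the `Pre` types, whose norm is `ksNorm`, so isometry
  -- means preservation of `ksNorm`.
  let L : S.Pre ≃ₗᵢ[𝕜] S'.Pre :=
    { (lpCompEquiv 𝕜 r e he : S.Pre ≃ₗ[𝕜] S'.Pre) with
      norm_map' := S.ksNorm_lpCompEquiv S' he ht hE }
  refine ⟨L.completionCongr, fun f hf hf' => ?_⟩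
  refine (L.completionCongr_coe _).trans (congrArg _ ?_)
  exact Lp.toLp_compMeasurePreserving hf (he.symm e)

end Transport

/-! ### The operator `T` and the basis norm. -/

section Canonical

variable {B : Type*} [NormedAddCommGroup B] [NormedSpace ℝ B]

/-- `T` as a measurable equivalence of `B` and `𝔹_J`. -/
noncomputable def canonMeasurableEquiv (b : SchauderBasis ℝ B) :
    @MeasurableEquiv B (BJ b) (canonSigma b) _ :=
  letI := canonSigma b
  { (canonT b).toEquiv with
    measurable_toFun := comap_measurable _
    measurable_invFun := by
      -- Every measurable set of `B` is some `T⁻¹(t)`, and its preimage under the inverse of `T` is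
      -- `t` again.
      rintro _ ⟨t, ht, rfl⟩
      convert ht using 1
      ext y
      exact iff_of_eq (congrArg (· ∈ t) ((canonT b).apply_symm_apply y)) }

theorem measurePreserving_canonMeasurableEquiv (b : SchauderBasis ℝ B) :
    @MeasurePreserving _ _ (canonSigma b) _ (canonMeasurableEquiv b) (volB b) (volBJ b) := by
  let := canonSigma b
  exact MeasurePreserving.symm (canonMeasurableEquiv b).symm
    ⟨(canonMeasurableEquiv b).symm.measurable, rfl⟩

/-- A convergent sequence is bounded. Without this the real supremum in `basisNorm` could be the
default value `0`. -/
theorem bddAbove_range_norm_proj (b : SchauderBasis ℝ B) (x : B) :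
    BddAbove (Set.range fun n => ‖b.proj n x‖) :=
  (b.tendsto_proj x).norm.bddAbove_range

theorem bjNorm_canonT (b : SchauderBasis ℝ B) (x : B) : bjNorm b (canonT b x) = basisNorm b x := by
  simp only [bjNorm, basisNorm, SchauderBasis.proj_apply]
  rfl

theorem norm_le_basisNorm (b : SchauderBasis ℝ B) (x : B) : ‖x‖ ≤ basisNorm b x :=
  le_of_tendsto' (b.tendsto_proj x).norm fun n => le_ciSup (bddAbove_range_norm_proj b x) n

theorem exists_basisNorm_le [CompleteSpace B] (b : SchauderBasis ℝ B) :
    ∃ C : ℝ, ∀ x, basisNorm b x ≤ C * ‖x‖ := by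
  -- The uniform bound on the operator norms of the `P_n`, where completeness enters.
  obtain ⟨C, hC⟩ := b.exists_norm_proj_le
  exact ⟨C, fun x => ciSup_le fun n => (b.proj n).le_of_opNorm_le (hC n) x⟩

end Canonical

theorem mainTheorem9 {𝕜 : Type*} [RCLike 𝕜] {B : Type*} [NormedAddCommGroup B] [NormedSpace ℝ B]
    [CompleteSpace B] (b : SchauderBasis ℝ B) (hb : ∀ k, ‖b k‖ = 1) :
    (∀ x : B, bjNorm b (canonT b x) = basisNorm b x) ∧
    (∃ C : ℝ, ∀ x : B, ‖x‖ ≤ basisNorm b x ∧ basisNorm b x ≤ C * ‖x‖) ∧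
    ∀ (r p : ℝ≥0∞) [Fact (1 ≤ r)] [Fact (1 ≤ p)],
      (∀ S : KSSystem 𝕜 (volB b) r p, ∃ S' : KSSystem 𝕜 (volBJ b) r p,
        IdentifiedBy (canonT b).toEquiv S S') ∧
      (∀ S' : KSSystem 𝕜 (volBJ b) r p, ∃ S : KSSystem 𝕜 (volB b) r p,
        IdentifiedBy (canonT b).toEquiv S S') := by
  let := canonSigma b
  have he := measurePreserving_canonMeasurableEquiv b
  obtain ⟨C, hC⟩ := exists_basisNorm_le b
  refine ⟨bjNorm_canonT b, ⟨C, fun x => ⟨norm_le_basisNorm b x, hC x⟩⟩, fun r p _ _ =>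
    ⟨fun S => ⟨S.transport _ he, S.identifiedBy _ he rfl fun _ => rfl⟩, fun S' => ?_⟩⟩
  -- The system on `B` is `S'` pulled back by `T`; what remains is that pulling back by `T` and then
  -- by `T⁻¹` returns each `S'.E k`.
  refine ⟨S'.transport _ (he.symm _), KSSystem.identifiedBy _ S' he rfl fun k => ?_⟩
  ext y
  change S'.E k y = S'.E k (canonMeasurableEquiv b ((canonMeasurableEquiv b).symm y))
  rw [MeasurableEquiv.apply_symm_apply]
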